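/- Let $k$ be an algebraically closed field of characteristic $0$ and let $(A,\mathfrak m)$ be an artinian Gorenstein local $k$-algebra. For an ideal $\mathfrak a$ of $A$ let $\mu(\mathfrak a)$ denote its minimal number of generators, and let $\ell(-)$ denote length. Suppose that $A$ is almost stretched, i.e. $\mu(\mathfrak m^2)=2$. Then $A$ is exact, i.e. $$\sup\{\mu(\mathfrak a) : \mathfrak a\subseteq \mathfrak m \text{ an ideal of } A\}=\inf\{\ell(A/xA) : x\in\mathfrak m\}.$$ -/

import Mathlib

universe u

/-- `μ(I)`: the minimal number of generators of an ideal, with value `⊤` if the ideal is not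
finitely generated. -/
noncomputable def Ideal.minGen {R : Type u} [CommRing R] (I : Ideal R) : ℕ∞ :=
  Cardinal.toENat (Submodule.spanRank I)

/-- The Dilworth number of a local ring `(R, 𝔪)`: the supremum of `μ(𝔞)` over the ideals
`𝔞 ⊆ 𝔪`. -/
noncomputable def dilworthNumber (R : Type u) [CommRing R] [IsLocalRing R] : ℕ∞ :=
  ⨆ I ∈ {I : Ideal R | I ≤ IsLocalRing.maximalIdeal R}, I.minGen

/-- The Rees number of a local ring `(R, 𝔪)`: the infimum of the lengths `ℓ(R / xR)` over
`x ∈ 𝔪`. -/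
noncomputable def reesNumber (R : Type u) [CommRing R] [IsLocalRing R] : ℕ∞ :=
  ⨅ x ∈ IsLocalRing.maximalIdeal R, Module.length R (R ⧸ Ideal.span {x})

/-- A local ring (noetherian, of Krull dimension at most one) is exact if its Dilworth number
equals its Rees number. -/
def IsExactLocalRing (R : Type u) [CommRing R] [IsLocalRing R] : Prop :=
  dilworthNumber R = reesNumber R

/-- A noetherian local ring is Gorenstein if it has finite injective dimension as a module over
itself. -/
def IsGorensteinLocalRing (R : Type u) [CommRing R] [IsLocalRing R] : Prop :=
  IsNoetherianRing R ∧
    ∃ n : ℕ, CategoryTheory.HasInjectiveDimensionLE (ModuleCat.of R R) n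

/-- An artinian local ring `(R, 𝔪)` is almost stretched if `μ(𝔪²) = 2`. -/
def IsAlmostStretched (R : Type u) [CommRing R] [IsLocalRing R] : Prop :=
  IsArtinianRing R ∧ (IsLocalRing.maximalIdeal R ^ 2).minGen = 2

open IsLocalRing

/-! For `x ∈ 𝔪`, multiplication by `x` maps an ideal `I` into `𝔪I` with kernel inside `(0 : x)`, and
`ℓ(0 : x) = ℓ(A/xA)`; hence `μ(I) ≤ ℓ(A/xA)`, so Dilworth ≤ Rees. Equality follows from a `w ∈ 𝔪`
with `𝔪² = w𝔪 ≠ 0`: then `𝔪² ⊊ wA`, so `ℓ(A/wA) ≤ ℓ(A/𝔪²) - 1 = μ(𝔪)`. Such a `w` exists because,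
`2` being a unit, squares of elements of `𝔪` generate `𝔪²`, so two of them suffice: `𝔪² = (x², y²)`.
Expanding `xy` in these generators shows that `x`, `y` or `x + y` serves as `w`. -/

/-- The number of generators of a finitely generated ideal of a local ring is the length of
`I / 𝔪 I`. -/
theorem Ideal.minGen_eq_length_quotient {A : Type*} [CommRing A] [IsLocalRing A] (I : Ideal A)
    (hI : I.FG) :
    I.minGen = Module.length A (I ⧸ maximalIdeal A • (⊤ : Submodule A I)) := by
  let : Field (A ⧸ maximalIdeal A) := Ideal.Quotient.field _
  have : Module.Finite A I := Module.Finite.iff_fg.mpr hI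
  have : Module.Finite (A ⧸ maximalIdeal A) (I ⧸ maximalIdeal A • (⊤ : Submodule A I)) :=
    Module.Finite.of_restrictScalars_finite A _ _
  rw [Ideal.minGen, Submodule.FG.spanRank_eq_spanFinrank hI, map_natCast,
    spanFinrank_eq_finrank_quotient I hI, ← Module.length_eq_finrank]
  exact (Module.length_eq_of_surjective (Ideal.Quotient.mk_surjective (I := maximalIdeal A))).symm

theorem Ideal.length_eq_minGen_add {A : Type*} [CommRing A] [IsLocalRing A] (I : Ideal A)
    (hI : I.FG) :
    Module.length A I = I.minGen + Module.length A ↥(maximalIdeal A * I) := by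
  have hmap : (maximalIdeal A • (⊤ : Submodule A I)).map I.subtype = maximalIdeal A * I := by
    rw [Submodule.map_smul'', Submodule.map_subtype_top, smul_eq_mul]
  have e := (Submodule.equivSubtypeMap I (maximalIdeal A • (⊤ : Submodule A I))).length_eq
  rw [hmap] at e
  rw [I.minGen_eq_length_quotient hI, ← e, add_comm]
  exact Module.length_eq_add_of_exact (Submodule.subtype _) (Submodule.mkQ _)
    (Submodule.subtype_injective _) (Submodule.mkQ_surjective _)
    (LinearMap.exact_subtype_mkQ _)

theorem Module.length_eq_length_ker_add_range {R M N : Type*} [Ring R] [AddCommGroup M]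
    [AddCommGroup N] [Module R M] [Module R N] (f : M →ₗ[R] N) :
    Module.length R M = Module.length R f.ker + Module.length R f.range :=
  Module.length_eq_add_of_exact f.ker.subtype f.rangeRestrict (Submodule.subtype_injective _)
    f.surjective_rangeRestrict
    (by rw [LinearMap.exact_iff, LinearMap.ker_rangeRestrict, Submodule.range_subtype])

theorem Module.length_eq_length_add_quotient {R M : Type*} [Ring R] [AddCommGroup M]
    [Module R M] (N : Submodule R M) :
    Module.length R M = Module.length R N + Module.length R (M ⧸ N) :=
  Module.length_eq_add_of_exact N.subtype N.mkQ N.subtype_injective N.mkQ_surjective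
    (LinearMap.exact_subtype_mkQ _)

theorem Submodule.length_mono {R M : Type*} [Ring R] [AddCommGroup M] [Module R M]
    {N P : Submodule R M} (h : N ≤ P) : Module.length R N ≤ Module.length R P :=
  Module.length_le_of_injective (Submodule.inclusion h) (Submodule.inclusion_injective h)

/-- Cokernel and kernel of an endomorphism of a finite-length module have equal length. -/
theorem length_quotient_span_singleton_eq_length_ker {A : Type*} [CommRing A] [IsArtinianRing A]
    (x : A) :
    Module.length A (A ⧸ Ideal.span {x}) = Module.length A (LinearMap.mulLeft A x).ker := by
  have h₁ := Module.length_eq_length_ker_add_range (LinearMap.mulLeft A x)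
  have h₂ := Module.length_eq_length_add_quotient (Ideal.span {x})
  have hr : (LinearMap.mulLeft A x).range = Ideal.span {x} := by
    ext y
    simp [Ideal.mem_span_singleton', mul_comm]
  rw [hr, h₂, add_comm] at h₁
  exact ENat.add_left_injective_of_ne_top Module.length_ne_top h₁

/-- In an artinian local ring, `μ(I) ≤ ℓ(A / xA)` for every ideal `I` and every `x ∈ 𝔪`. -/
theorem Ideal.minGen_le_length_quotient {A : Type*} [CommRing A] [IsLocalRing A]
    [IsArtinianRing A] (I : Ideal A) {x : A} (hx : x ∈ maximalIdeal A) :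
    I.minGen ≤ Module.length A (A ⧸ Ideal.span {x}) := by
  have hlen := I.length_eq_minGen_add (IsNoetherian.noetherian I)
  let f : I →ₗ[A] A := LinearMap.mulLeft A x ∘ₗ I.subtype
  have hr : f.range ≤ maximalIdeal A * I := by
    rintro _ ⟨y, rfl⟩
    exact Ideal.mul_mem_mul hx y.2
  have hk : Module.length A f.ker ≤ Module.length A (LinearMap.mulLeft A x).ker :=
    Module.length_le_of_injective
      ((I.subtype ∘ₗ f.ker.subtype).codRestrict _ fun y ↦ y.2)
      fun a b h ↦ Subtype.ext (Subtype.ext (congrArg (LinearMap.mulLeft A x).ker.subtype h))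
  rw [Module.length_eq_length_ker_add_range f] at hlen
  rw [length_quotient_span_singleton_eq_length_ker]
  refine (ENat.add_le_add_iff_right (k := Module.length A ↥(maximalIdeal A * I))
    Module.length_ne_top).mp ?_
  rw [← hlen]
  exact add_le_add hk (Submodule.length_mono hr)

theorem dilworthNumber_le_reesNumber (A : Type*) [CommRing A] [IsLocalRing A]
    [IsArtinianRing A] : dilworthNumber A ≤ reesNumber A :=
  iSup₂_le fun I _ ↦ le_iInf₂ fun _ hx ↦ I.minGen_le_length_quotient hx

/-- If `𝔪² ≠ 0` is contained in `w𝔪`, then `ℓ(A / wA) ≤ μ(𝔪)`. -/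
theorem length_quotient_le_minGen_maximalIdeal {A : Type*} [CommRing A] [IsLocalRing A]
    [IsArtinianRing A] {w : A} (hne : maximalIdeal A ^ 2 ≠ ⊥)
    (h : maximalIdeal A ^ 2 ≤ Ideal.span {w} * maximalIdeal A) :
    Module.length A (A ⧸ Ideal.span {w}) ≤ (maximalIdeal A).minGen := by
  -- If `𝔪² = wA`, the hypothesis becomes `𝔪² ≤ 𝔪²·𝔪`, and Nakayama gives `𝔪² = 0`.
  have hlt : maximalIdeal A ^ 2 < Ideal.span {w} := by
    refine lt_of_le_of_ne (h.trans Ideal.mul_le_left) fun heq ↦ hne ?_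
    refine Submodule.eq_bot_of_le_smul_of_le_jacobson_bot (maximalIdeal A) _
      (IsNoetherian.noetherian _) ?_ (maximalIdeal_le_jacobson _)
    rw [smul_eq_mul, mul_comm]
    conv_lhs => rw [heq]
    rw [heq] at h ⊢
    exact h
  have h₁ := Module.length_eq_length_add_quotient (Ideal.span {w})
  have h₂ := Module.length_eq_length_add_quotient (maximalIdeal A)
  have h₃ := (maximalIdeal A).length_eq_minGen_add (IsNoetherian.noetherian _)
  have hs : IsSimpleModule A (A ⧸ maximalIdeal A) := by
    rw [isSimpleModule_iff_isCoatom]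
    exact (maximalIdeal.isMaximal A).out
  -- Strictness gains the `1` that cancels `ℓ(A/𝔪)`.
  have h₄ : Module.length A ↥(maximalIdeal A ^ 2) + 1 ≤ Module.length A (Ideal.span {w}) := by
    rw [Module.length_submodule, Module.length_submodule]
    exact Order.add_one_le_of_lt (Submodule.height_strictMono hlt)
  rw [Module.length_eq_one A (A ⧸ maximalIdeal A), h₃, ← sq] at h₂
  refine (ENat.add_le_add_iff_left (k := Module.length A (Ideal.span {w}))
    Module.length_ne_top).mp ?_
  rw [← h₁, h₂, add_assoc, add_comm]
  exact add_le_add_left h₄ _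

/-- Both numbers are squeezed to `μ(𝔪)`. -/
theorem isExactLocalRing_of_maximalIdeal_sq_le {A : Type*} [CommRing A] [IsLocalRing A]
    [IsArtinianRing A] {w : A} (hw : w ∈ maximalIdeal A) (hne : maximalIdeal A ^ 2 ≠ ⊥)
    (h : maximalIdeal A ^ 2 ≤ Ideal.span {w} * maximalIdeal A) : IsExactLocalRing A := by
  refine le_antisymm (dilworthNumber_le_reesNumber A) ?_
  calc reesNumber A ≤ Module.length A (A ⧸ Ideal.span {w}) := iInf₂_le w hw
    _ ≤ (maximalIdeal A).minGen := length_quotient_le_minGen_maximalIdeal hne h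
    _ ≤ dilworthNumber A := le_iSup₂_of_le (maximalIdeal A) (le_refl (maximalIdeal A)) le_rfl

theorem Ideal.exists_span_pair_of_minGen_eq_two {A : Type*} [CommRing A] {I : Ideal A}
    (h : I.minGen = 2) : ∃ f g, I = Ideal.span {f, g} := by
  obtain ⟨s, hs, hspan⟩ := Submodule.exists_span_set_card_eq_spanRank I
  have hs2 : Cardinal.mk s = 2 := by
    rw [hs]
    exact Cardinal.toENat_eq_ofNat.mp h
  obtain ⟨f, g, hfg⟩ : ∃ f g, s = {f, g} := by
    obtain ⟨f, g, -, hfg⟩ := Cardinal.mk_eq_two_iff.mp hs2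
    refine ⟨f, g, ?_⟩
    simpa [Set.image_pair] using congrArg (Set.image Subtype.val) hfg.symm
  exact ⟨f, g, by rw [← hfg]; exact hspan.symm⟩

/-- Polarization: `2ab` is a combination of squares. -/
theorem Ideal.sq_le_span_sq {A : Type*} [CommRing A] (h2 : IsUnit (2 : A)) (I : Ideal A) :
    I ^ 2 ≤ Ideal.span {y | ∃ z ∈ I, z ^ 2 = y} := by
  rw [sq, Ideal.mul_le]
  intro a ha b hb
  rw [← (Ideal.span _).unit_mul_mem_iff_mem h2]
  have key : 2 * (a * b) = (a + b) ^ 2 - a ^ 2 - b ^ 2 := by ring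
  rw [key]
  exact sub_mem (sub_mem (Ideal.subset_span ⟨_, add_mem ha hb, rfl⟩)
    (Ideal.subset_span ⟨_, ha, rfl⟩)) (Ideal.subset_span ⟨_, hb, rfl⟩)

/-- Exchange property: if a set `S` containing `0` generates the ideal `(f, g)` of a local ring,
then `g` can be exchanged for an element of `S`. -/
theorem Ideal.exists_span_pair_exchange {A : Type*} [CommRing A] [IsLocalRing A] {S : Set A}
    (h0 : (0 : A) ∈ S) {f g : A} (hS : Ideal.span S = Ideal.span {f, g}) :
    ∃ s ∈ S, Ideal.span {f, g} = Ideal.span {f, s} := by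
  have hf : f ∈ Ideal.span {f, g} := Ideal.subset_span (by simp)
  have hg : g ∈ Ideal.span {f, g} := Ideal.subset_span (by simp)
  by_cases hex : ∃ s ∈ S, ∃ a b, a * f + b * g = s ∧ IsUnit b
  · obtain ⟨s, hs, a, b, hab, hb⟩ := hex
    refine ⟨s, hs, le_antisymm ?_ ?_⟩
    · rw [Ideal.span_le, Set.pair_subset_iff]
      refine ⟨Ideal.subset_span (by simp), ?_⟩
      rw [SetLike.mem_coe, ← (Ideal.span {f, s}).unit_mul_mem_iff_mem hb]
      exact Ideal.mem_span_pair.mpr ⟨-a, 1, by rw [← hab]; ring⟩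
    · rw [Ideal.span_le, Set.pair_subset_iff]
      exact ⟨hf, hS ▸ Ideal.subset_span hs⟩
  · push Not at hex
    -- Every element of `S` now lies in `(f) + 𝔪g`, so by Nakayama `g` is redundant and `0` can
    -- replace it.
    refine ⟨0, h0, le_antisymm ?_ ?_⟩
    · refine Submodule.le_of_le_smul_of_le_jacobson_bot (I := maximalIdeal A)
        (Submodule.fg_span (Set.toFinite _)) (maximalIdeal_le_jacobson _) ?_
      conv_lhs => rw [← hS]
      refine Ideal.span_le.mpr fun s hs ↦ ?_
      obtain ⟨a, b, hab⟩ := Ideal.mem_span_pair.mp (hS ▸ Ideal.subset_span hs : s ∈ span {f, g})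
      rw [← hab]
      refine Submodule.add_mem_sup (Ideal.mul_mem_left _ _ (Ideal.subset_span (by simp)))
        (Submodule.smul_mem_smul ?_ hg)
      exact (mem_maximalIdeal b).mpr (hex s hs a b hab)
    · rw [Ideal.span_le, Set.pair_subset_iff]
      exact ⟨hf, zero_mem _⟩

theorem Ideal.exists_sq_eq_span_pair_sq {A : Type*} [CommRing A] [IsLocalRing A]
    (h2 : IsUnit (2 : A)) {I : Ideal A} (hI : (I ^ 2).minGen = 2) :
    ∃ x ∈ I, ∃ y ∈ I, I ^ 2 = Ideal.span {x ^ 2, y ^ 2} := by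
  obtain ⟨f, g, hfg⟩ := Ideal.exists_span_pair_of_minGen_eq_two hI
  have hS : Ideal.span {y | ∃ z ∈ I, z ^ 2 = y} = I ^ 2 := by
    refine le_antisymm (Ideal.span_le.mpr ?_) (I.sq_le_span_sq h2)
    rintro _ ⟨z, hz, rfl⟩
    exact Ideal.pow_mem_pow hz 2
  have h0 : (0 : A) ∈ {y | ∃ z ∈ I, z ^ 2 = y} := ⟨0, zero_mem _, by simp⟩
  obtain ⟨_, ⟨x, hx, rfl⟩, hfx⟩ := Ideal.exists_span_pair_exchange h0 (hS.trans hfg)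
  -- Swapping the generators lets the second exchange replace `f`.
  rw [hfx, Set.pair_comm] at hfg
  obtain ⟨_, ⟨y, hy, rfl⟩, hxy⟩ := Ideal.exists_span_pair_exchange h0 (hS.trans hfg)
  exact ⟨x, hx, y, hy, hfg.trans hxy⟩

/-- If the square of the maximal ideal is generated by two squares, then `𝔪² = w𝔪` for some
`w ∈ 𝔪`. -/
theorem exists_maximalIdeal_sq_le_span_mul {A : Type*} [CommRing A] [IsLocalRing A] {x y : A}
    (hx : x ∈ maximalIdeal A) (hy : y ∈ maximalIdeal A)
    (hxy : maximalIdeal A ^ 2 = Ideal.span {x ^ 2, y ^ 2}) :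
    ∃ w ∈ maximalIdeal A, maximalIdeal A ^ 2 ≤ Ideal.span {w} * maximalIdeal A := by
  have hmem : x * y ∈ maximalIdeal A ^ 2 := sq (maximalIdeal A) ▸ Ideal.mul_mem_mul hx hy
  obtain ⟨a, b, hab⟩ := Ideal.mem_span_pair.mp (hxy ▸ hmem)
  by_cases hb : IsUnit b
  -- Here `b y² = x (y - a x)`, so `y²` lies in `x𝔪` along with `x²`.
  · refine ⟨x, hx, ?_⟩
    rw [hxy, Ideal.span_le, Set.pair_subset_iff]
    refine ⟨Ideal.mem_span_singleton_mul.mpr ⟨x, hx, (sq x).symm⟩, ?_⟩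
    rw [SetLike.mem_coe, ← (Ideal.span {x} * maximalIdeal A).unit_mul_mem_iff_mem hb]
    exact Ideal.mem_span_singleton_mul.mpr
      ⟨y - a * x, sub_mem hy (Ideal.mul_mem_left _ _ hx), by linear_combination -hab⟩
  by_cases ha : IsUnit a
  · refine ⟨y, hy, ?_⟩
    rw [hxy, Ideal.span_le, Set.pair_subset_iff]
    refine ⟨?_, Ideal.mem_span_singleton_mul.mpr ⟨y, hy, (sq y).symm⟩⟩
    rw [SetLike.mem_coe, ← (Ideal.span {y} * maximalIdeal A).unit_mul_mem_iff_mem ha]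
    exact Ideal.mem_span_singleton_mul.mpr
      ⟨x - b * y, sub_mem hx (Ideal.mul_mem_left _ _ hy), by linear_combination -hab⟩
  have hm : x * y ∈ maximalIdeal A * maximalIdeal A ^ 2 := by
    rw [← hab]
    exact add_mem (Ideal.mul_mem_mul ((mem_maximalIdeal a).mpr ha) (Ideal.pow_mem_pow hx 2))
      (Ideal.mul_mem_mul ((mem_maximalIdeal b).mpr hb) (Ideal.pow_mem_pow hy 2))
  -- As `xy ∈ 𝔪³`, modulo `𝔪³` the generators are `x² ≡ (x + y)x` and `y² ≡ (x + y)y`; Nakayama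
  -- removes the error.
  refine ⟨x + y, add_mem hx hy, ?_⟩
  refine Submodule.le_of_le_smul_of_le_jacobson_bot (I := maximalIdeal A)
    (hxy ▸ Submodule.fg_span (Set.toFinite _)) (maximalIdeal_le_jacobson _) ?_
  conv_lhs => rw [hxy]
  have hmul {z : A} (hz : z ∈ maximalIdeal A) :
      (x + y) * z ∈ Ideal.span {x + y} * maximalIdeal A :=
    Ideal.mem_span_singleton_mul.mpr ⟨z, hz, rfl⟩
  rw [Ideal.span_le, Set.pair_subset_iff]
  constructor
  · rw [show x ^ 2 = (x + y) * x + -(x * y) by ring]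
    exact Submodule.add_mem_sup (hmul hx) (neg_mem hm)
  · rw [show y ^ 2 = (x + y) * y + -(x * y) by ring]
    exact Submodule.add_mem_sup (hmul hy) (neg_mem hm)

/-- An almost stretched artinian local ring in which `2` is invertible is exact. -/
theorem IsAlmostStretched.isExactLocalRing {A : Type*} [CommRing A] [IsLocalRing A]
    (h2 : IsUnit (2 : A)) (hA : IsAlmostStretched A) : IsExactLocalRing A := by
  obtain ⟨_, hgen⟩ := hA
  obtain ⟨x, hx, y, hy, hxy⟩ := Ideal.exists_sq_eq_span_pair_sq h2 hgen
  obtain ⟨w, hw, hle⟩ := exists_maximalIdeal_sq_le_span_mul hx hy hxy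
  refine isExactLocalRing_of_maximalIdeal_sq_le hw (fun hbot ↦ ?_) hle
  rw [Ideal.minGen, hbot, Submodule.spanRank_eq_zero_iff_eq_bot.mpr rfl] at hgen
  simp at hgen

theorem mainTheorem4 {k A : Type*} [Field k] [IsAlgClosed k] [CharZero k]
    [CommRing A] [IsLocalRing A] [Algebra k A]
    (hG : IsGorensteinLocalRing A) (hA : IsAlmostStretched A) :
    IsExactLocalRing A := by
  have h2 : IsUnit (2 : A) := by
    rw [← map_ofNat (algebraMap k A) 2]
    exact (isUnit_iff_ne_zero.mpr two_ne_zero).map (algebraMap k A)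
  exact hA.isExactLocalRing h2
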